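/- Let $\mathbb{F}_q$ be a finite field with $q$ elements, let $\varphi:\{0,1,\ldots,q-1\}\to\mathbb{F}_q$ be a bijection with $\varphi(0)=0$, and let $s\ge 1$. *Bases.* For $m\in\mathbb{N}$ let $R_m=\mathbb{F}_q[x]/(x^m)$. For $1\le i\le s$ and $m\in\mathbb{N}$ let $\mathfrak{B}_{m,i}=(\mathfrak{b}_{m,i,1},\ldots,\mathfrak{b}_{m,i,m})$ be an ordered $\mathbb{F}_q$-basis of $R_m$ such that, for all $1\le j\le m$, the elements $\mathfrak{b}_{m,i,j}\in R_m$ and $\mathfrak{b}_{m+1,i,j}\in R_{m+1}$ are represented by the same polynomial of degree less than $m$. Let $\theta_m:R_m^s\to\mathbb{F}_q^{sm}$ map $(k_1,\ldots,k_s)$ to the concatenation of the coordinate vectors of $k_i$ with respect to $\mathfrak{B}_{m,i}$, $i=1,\ldots,s$. *Hyperplane sequences.* Let $Y$ be the set of all $\alpha\in\mathbb{F}_q[[x]]$ with $\gcd(\alpha \bmod x^m,x^m)=1$ for all $m\in\mathbb{N}$. For $\boldsymbol{\alpha}=(\alpha_1,\ldots,\alpha_s)\in Y^s$ put $$\mathcal{N}_m=\theta_m\Big(\Big\{(k_1,\ldots,k_s)\in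 R_m^s : \sum_{i=1}^s\alpha_ik_i\equiv 0 \pmod{x^m}\Big\}\Big)\subseteq\mathbb{F}_q^{sm}.$$ Let $C_1,\ldots,C_s\in\mathbb{F}_q^{\mathbb{N}\times\mathbb{N}}$ be matrices such that for every $m\in\mathbb{N}$ the row space of $(C_1^{(m)\top}\cdots C_s^{(m)\top})\in\mathbb{F}_q^{m\times sm}$, where $C_i^{(m)}$ is the left upper $m\times m$ submatrix of $C_i$, equals the orthogonal complement of $\mathcal{N}_m$ with respect to the standard inner product. For $k\in\mathbb{N}_0$ with base-$q$ expansion $k=\kappa_0+\kappa_1q+\cdots$ let $(y_{i,1}(k),y_{i,2}(k),\ldots)^\top=C_i(\varphi(\kappa_0),\varphi(\kappa_1),\ldots)^\top$ and $$\boldsymbol{x}_k=(x_{k,1},\ldots,x_{k,s}),\qquad x_{k,i}=\sum_{j\ge1}\varphi^{-1}(y_{i,j}(k))\,q^{-j}.$$ The sequence $\mathcal{S}_{\boldsymbol{\alpha}}=(\boldsymbol{x}_k)_{k\ge0}$ is called a hyperplane sequence associated with $\boldsymbol{\alpha}$. **Theorem.** Let $\boldsymbol{\alpha}=(\alpha_1,\ldots,\alpha_s)\in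 Y^s$. Every hyperplane sequence $\mathcal{S}_{\boldsymbol{\alpha}}$ associated with $\boldsymbol{\alpha}$ is uniformly distributed modulo one (i.e. for every box $\prod_{i=1}^s[a_i,b_i)\subseteq[0,1)^s$ with all $a_i<b_i$ the proportion of indices $n<N$ for which the vector of fractional parts of the coordinates of $\boldsymbol{x}_n$ lies in the box tends to $\prod_{i=1}^s(b_i-a_i)$ as $N\to\infty$) if and only if $\alpha_1,\ldots,\alpha_s$ are linearly independent over $\mathbb{F}_q[x]$. -/

import Mathlib

open scoped Polynomial PowerSeries
open Filter Topology

namespace HyperplaneSeq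

/-- The residue class ring `R_m = F[x]/(x^m)`. -/
abbrev ResidueRing (F : Type*) [Field F] (m : ℕ) : Type _ :=
  F[X] ⧸ Ideal.span {(Polynomial.X : F[X]) ^ m}

/-- The residue class modulo `x^m` of a polynomial. -/
noncomputable def residue {F : Type*} [Field F] (m : ℕ) (p : F[X]) : ResidueRing F m :=
  Ideal.Quotient.mk (Ideal.span {(Polynomial.X : F[X]) ^ m}) p

/-- Ordered bases `𝔅_{m,i}` of `R_m` over `F`, for all `m` and all `i = 1, …, s`, such that
`𝔟_{m+1,i,j} = (𝔟_{m,i,j}, 0)` in canonical coordinates for `j ≤ m`: the same polynomial of degree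
less than `m` represents `𝔟_{m,i,j}` in `R_m` and `𝔟_{m+1,i,j}` in `R_{m+1}`.
(The level `m = 0`, where `R_0` is the zero ring, carries no information.) -/
structure NestedBases (F : Type*) [Field F] (s : ℕ) where
  basis : (m : ℕ) → Fin s → Module.Basis (Fin m) F (ResidueRing F m)
  nested : ∀ (m : ℕ) (i : Fin s) (j : Fin m), ∃ p : F[X], p.degree < (m : WithBot ℕ) ∧
    basis m i j = residue m p ∧ basis (m + 1) i j.castSucc = residue (m + 1) p

/-- The set `Y` of power series whose reduction modulo `x^m` is coprime to `x^m` for all `m ≥ 1`. -/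
def Y (F : Type*) [Field F] : Set F⟦X⟧ :=
  {a | ∀ m : ℕ, 1 ≤ m → IsCoprime (PowerSeries.trunc m a) ((Polynomial.X : F[X]) ^ m)}

/-- The space `N'_{α^{(m)}} = {k ∈ R_m^s : α^{(m)} · k = 0}`, where `α^{(m)}` is the reduction of
`α` modulo `x^m`. -/
def hyperplane {F : Type*} [Field F] {s : ℕ} (α : Fin s → F⟦X⟧) (m : ℕ) :
    Submodule F (Fin s → ResidueRing F m) where
  carrier := {k | ∑ i, residue m (PowerSeries.trunc m (α i)) * k i = 0}
  add_mem' := by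
    intro a b ha hb
    simp only [Set.mem_ofPred_eq, Pi.add_apply, mul_add, Finset.sum_add_distrib] at *
    rw [ha, hb, add_zero]
  zero_mem' := by simp
  smul_mem' := by
    intro c a ha
    simp only [Set.mem_ofPred_eq, Pi.smul_apply, mul_smul_comm] at *
    rw [← Finset.smul_sum, ha, smul_zero]

/-- The coordinate map `θ_m : R_m^s → F^{sm}` with respect to the chosen bases. The coordinates of
`F^{sm}` are indexed by pairs (block, position in the block). -/
noncomputable def theta {F : Type*} [Field F] {s : ℕ} (B : NestedBases F s) (m : ℕ) :
    (Fin s → ResidueRing F m) →ₗ[F] (Fin s × Fin m → F) where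
  toFun k := fun ij => (B.basis m ij.1).repr (k ij.1) ij.2
  map_add' := by intro a b; ext ij; simp
  map_smul' := by intro c a; ext ij; simp

/-- The space `N_{α^{(m)}} = θ_m(N'_{α^{(m)}})`. -/
noncomputable def dualChain {F : Type*} [Field F] {s : ℕ} (B : NestedBases F s)
    (α : Fin s → F⟦X⟧) (m : ℕ) : Submodule F (Fin s × Fin m → F) :=
  (hyperplane α m).map (theta B m)

/-- The orthogonal complement with respect to the standard inner product. -/
def orthogonal {F ι : Type*} [Field F] [Fintype ι] (N : Submodule F (ι → F)) :
    Submodule F (ι → F) where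
  carrier := {a | ∀ b ∈ N, b ⬝ᵥ a = 0}
  add_mem' := by
    intro a a' ha ha' b hb
    rw [dotProduct_add, ha b hb, ha' b hb, add_zero]
  zero_mem' := by intro b _; exact dotProduct_zero b
  smul_mem' := by
    intro c a ha b hb
    rw [dotProduct_smul, ha b hb, smul_zero]

/-- The `m`-th overall generating matrix `C^{(m)} = (C_1^{(m)ᵀ} ⋯ C_s^{(m)ᵀ}) ∈ F^{m × sm}`, where
`C_i^{(m)}` is the left upper `m × m` submatrix of `C_i`; rows and columns are counted from `0`. -/
def overall {F : Type*} {s : ℕ} (C : Fin s → Matrix ℕ ℕ F) (m : ℕ) :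
    Matrix (Fin m) (Fin s × Fin m) F :=
  Matrix.of fun r ij => C ij.1 ij.2 r

/-- The row space of a matrix. -/
def rowSpace {F m n : Type*} [Field F] (A : Matrix m n F) : Submodule F (n → F) :=
  Submodule.span F (Set.range A.row)

/-- `C_1, …, C_s` are generating matrices obtained from `α`: for all `m`, the row space of the
`m`-th overall generating matrix is the orthogonal complement of `N_{α^{(m)}}`. -/
def IsGenerating {F : Type*} [Field F] {s : ℕ} (B : NestedBases F s) (α : Fin s → F⟦X⟧)
    (C : Fin s → Matrix ℕ ℕ F) : Prop :=
  ∀ m : ℕ, rowSpace (overall C m) = orthogonal (dualChain B α m)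

/-- The digit `κ_r` of `k = κ_0 + κ_1 q + ⋯` in base `q = |F|`. -/
def digit (F : Type*) [Fintype F] [Nonempty F] (k r : ℕ) : Fin (Fintype.card F) :=
  ⟨k / Fintype.card F ^ r % Fintype.card F, Nat.mod_lt _ Fintype.card_pos⟩

/-- The entry in position `j` of `C k⃗`, with `k⃗ = (φ(κ_0), φ(κ_1), …)ᵀ`. The sum is finite when
`φ 0 = 0`. -/
noncomputable def digitalVec {F : Type*} [Field F] [Fintype F] (φ : Fin (Fintype.card F) ≃ F)
    (C : Matrix ℕ ℕ F) (k j : ℕ) : F :=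
  ∑ᶠ r : ℕ, C j r * φ (digit F k r)

/-- The digital sequence over `F` with generating matrices `C_1, …, C_s`; its `k`-th point has
coordinates `x_{k,i} = φ⁻¹(y_{i,1}(k))/q + φ⁻¹(y_{i,2}(k))/q² + ⋯`. -/
noncomputable def digitalSeq {F : Type*} [Field F] [Fintype F] (φ : Fin (Fintype.card F) ≃ F)
    {s : ℕ} (C : Fin s → Matrix ℕ ℕ F) (k : ℕ) (i : Fin s) : ℝ :=
  Real.ofDigits fun j => φ.symm (digitalVec φ (C i) k j)

/-- `x` is a hyperplane sequence associated with `α` (with respect to the bijection `φ` and the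
bases `B`). -/
def IsHyperplaneSeq {F : Type*} [Field F] [Fintype F] (φ : Fin (Fintype.card F) ≃ F) {s : ℕ}
    (B : NestedBases F s) (α : Fin s → F⟦X⟧) (x : ℕ → Fin s → ℝ) : Prop :=
  ∃ C : Fin s → Matrix ℕ ℕ F, IsGenerating B α C ∧ x = digitalSeq φ C

/-- Uniform distribution modulo one: for every box `[a_1,b_1) × ⋯ × [a_s,b_s) ⊆ [0,1)^s`, the
proportion of those among the first `N` points whose fractional parts lie in the box tends to the
volume of the box. -/
def UniformlyDistributedModOne {s : ℕ} (x : ℕ → Fin s → ℝ) : Prop :=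
  ∀ a b : Fin s → ℝ, (∀ i, 0 ≤ a i ∧ a i < b i ∧ b i ≤ 1) →
    Tendsto
      (fun N : ℕ =>
        (Set.ncard {n : ℕ | n < N ∧ ∀ i, Int.fract (x n i) ∈ Set.Ico (a i) (b i)} : ℝ) / N)
      atTop (𝓝 (∏ i, (b i - a i)))

end HyperplaneSeq

/-! Both sides are equivalent to `JointlyIndependent C`: no nontrivial finite linear relation holds
among the rows of all the `C i` together.

Algebra (`IsGenerating.jointlyIndependent_iff`): nestedness makes the bases residues of fixed
polynomials `P i j`, where `P i 0, …, P i (d-1)` is a basis of the polynomials of degree less than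
`d`. Coefficients `c i j` thus encode arbitrary polynomials `k i = ∑ j, c i j • P i j`. Since the
row space is the orthogonal complement of the dual space, double orthogonality turns a relation with
coefficients `c` in the first `m` columns into `∑ i, k i * α i ≡ 0` modulo `x^m`; letting `m` grow
gives a relation over `F[X]`.

Distribution (`digitalSeq_uniformlyDistributedModOne_iff`): if the rows are jointly independent, the
first `d` rows of all matrices are already independent in some first `m` columns, because only
finitely many coefficient vectors have to be excluded. Every block of `q^m` consecutive indices then
hits each of the `q^(ds)` cells of side `q^(-d)` equally often, and boxes are approximated by cells.
Conversely, a relation among the rows is inherited by the output digits of every point, so a cell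
whose digits violate it stays empty. -/

namespace HyperplaneSeq

/-! ### Row relations and polynomial relations -/

section Algebra

variable {F : Type*} [Field F]

theorem residue_mul (m : ℕ) (p p' : F[X]) : residue m (p * p') = residue m p * residue m p' :=
  map_mul _ p p'

theorem residue_sum {ι : Type*} (m : ℕ) (t : Finset ι) (f : ι → F[X]) :
    residue m (∑ i ∈ t, f i) = ∑ i ∈ t, residue m (f i) :=
  map_sum (Ideal.Quotient.mk _) f t

theorem residue_smul (m : ℕ) (c : F) (p : F[X]) : residue m (c • p) = c • residue m p :=
  rfl

theorem residue_eq_iff (m : ℕ) (p p' : F[X]) :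
    residue m p = residue m p' ↔ (Polynomial.X : F[X]) ^ m ∣ p - p' := by
  rw [residue, residue, Ideal.Quotient.eq, Ideal.mem_span_singleton]

theorem residue_eq_zero_iff (m : ℕ) (p : F[X]) :
    residue m p = 0 ↔ (Polynomial.X : F[X]) ^ m ∣ p := by
  rw [residue, Ideal.Quotient.eq_zero_iff_mem, Ideal.mem_span_singleton]

theorem eq_of_residue_eq {m : ℕ} {p p' : F[X]} (hp : p.degree < (m : WithBot ℕ))
    (hp' : p'.degree < (m : WithBot ℕ)) (h : residue m p = residue m p') : p = p' := by
  rw [residue_eq_iff] at h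
  refine sub_eq_zero.1 (Polynomial.eq_zero_of_dvd_of_degree_lt h ?_)
  rw [Polynomial.degree_X_pow]
  exact (Polynomial.degree_sub_le _ _).trans_lt (max_lt hp hp')

/-- The elements of nested bases are the residues of polynomials that do not depend on the level. -/
theorem NestedBases.exists_polynomials {s : ℕ} (B : NestedBases F s) :
    ∃ P : Fin s → ℕ → F[X], (∀ i j, (P i j).degree < ((j + 1 : ℕ) : WithBot ℕ)) ∧
      ∀ m i (j : Fin m), B.basis m i j = residue m (P i j) := by
  choose P hdeg hP hP' using fun (i : Fin s) (j : ℕ) => B.nested (j + 1) i (Fin.last j)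
  refine ⟨P, hdeg, fun m i j => ?_⟩
  have key : ∀ (m : ℕ) (j : ℕ) (hj : j < m), B.basis m i ⟨j, hj⟩ = residue m (P i j) := by
    intro m
    induction m with
    | zero => intro j hj; omega
    | succ m ih =>
      intro j hj
      rcases Nat.lt_succ_iff_lt_or_eq.1 hj with h | rfl
      -- The representative of degree less than `m` is unique, so `p` is the polynomial `P i j`
      -- fixed at level `j + 1`.
      · obtain ⟨p, hp, hp1, hp2⟩ := B.nested m i ⟨j, h⟩
        have hlt : (P i j).degree < (m : WithBot ℕ) :=
          (hdeg i j).trans_le (by exact_mod_cast h)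
        have : p = P i j := eq_of_residue_eq hp hlt (by rw [← hp1, ih j h])
        subst this
        exact hp2
      · exact hP i j
  exact key m j j.2

/-- A vector outside `N` is separated from `N` by a linear functional, and every functional on `ι →
F` is a dot product. -/
theorem mem_orthogonal_orthogonal {ι : Type*} [Fintype ι] (N : Submodule F (ι → F)) (v : ι → F) :
    v ∈ orthogonal (orthogonal N) ↔ v ∈ N := by
  classical
  constructor
  · intro h
    by_contra hv
    obtain ⟨f, hf, hN⟩ := Submodule.exists_le_ker_of_notMem hv
    obtain ⟨a, rfl⟩ := (dotProductEquiv F ι).surjective f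
    refine hf ?_
    refine h a fun b hb => ?_
    have := hN hb
    rw [LinearMap.mem_ker] at this
    rw [dotProduct_comm]
    exact this
  · intro h a ha
    rw [dotProduct_comm]
    exact ha v h

theorem mem_orthogonal_rowSpace {ι κ : Type*} [Fintype ι] (A : Matrix κ ι F) (v : ι → F) :
    v ∈ orthogonal (rowSpace A) ↔ ∀ r, A r ⬝ᵥ v = 0 := by
  constructor
  · intro h r
    exact h _ (Submodule.subset_span ⟨r, rfl⟩)
  · intro h b hb
    induction hb using Submodule.span_induction with
    | mem x hx => obtain ⟨r, rfl⟩ := hx; exact h r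
    | zero => exact zero_dotProduct v
    | add x y _ _ hx hy => rw [add_dotProduct, hx, hy, add_zero]
    | smul c x _ hx => rw [smul_dotProduct, hx, smul_zero]

theorem theta_injective {s : ℕ} (B : NestedBases F s) (m : ℕ) :
    Function.Injective (theta B m) := by
  intro a b h
  funext i
  refine (B.basis m i).repr.injective (Finsupp.ext fun j => ?_)
  exact congrFun h (i, j)

theorem theta_mem_dualChain {s : ℕ} (B : NestedBases F s) (α : Fin s → F⟦X⟧) (m : ℕ)
    (k : Fin s → ResidueRing F m) : theta B m k ∈ dualChain B α m ↔ k ∈ hyperplane α m :=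
  ⟨fun ⟨_, hk', h⟩ => theta_injective B m h ▸ hk', fun h => ⟨k, h, rfl⟩⟩

theorem residue_mem_hyperplane {s : ℕ} (α : Fin s → F⟦X⟧) (m : ℕ) (k : Fin s → F[X]) :
    (fun i => residue m (k i)) ∈ hyperplane α m ↔
      ∀ n < m, PowerSeries.coeff n (∑ i, (k i : F⟦X⟧) * α i) = 0 := by
  change ∑ i, residue m (PowerSeries.trunc m (α i)) * residue m (k i) = 0 ↔ _
  simp_rw [← residue_mul]
  rw [← residue_sum, residue_eq_zero_iff, Polynomial.X_pow_dvd_iff]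
  refine forall₂_congr fun n hn => ?_
  rw [Polynomial.finsetSum_coeff, map_sum]
  refine Eq.congr (Finset.sum_congr rfl fun i _ => ?_) rfl
  rw [PowerSeries.coeff_mul, mul_comm, Polynomial.coeff_mul]
  refine Finset.sum_congr rfl fun x hx => ?_
  have : x.2 < m := by
    have := Finset.HasAntidiagonal.mem_antidiagonal.1 hx
    omega
  rw [PowerSeries.coeff_trunc, if_pos this, Polynomial.coeff_coe]

/-- The rows of `C_1, …, C_s` are jointly linearly independent. -/
def JointlyIndependent {s : ℕ} (C : Fin s → Matrix ℕ ℕ F) : Prop :=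
  ∀ (d : ℕ) (c : Fin s → ℕ → F),
    (∀ r, ∑ i, ∑ j ∈ Finset.range d, c i j * C i j r = 0) → ∀ i, ∀ j < d, c i j = 0

theorem sum_range_eq_sum_fin {M : Type*} [AddCommMonoid M] {d m : ℕ} (h : d ≤ m) (f : ℕ → M) :
    ∑ j ∈ Finset.range d, f j = ∑ j : Fin m, if (j : ℕ) < d then f j else 0 := by
  rw [Fin.sum_univ_eq_sum_range (fun j => if j < d then f j else 0) m]
  rw [← Finset.sum_filter]
  refine Finset.sum_congr ?_ fun _ _ => rfl
  ext j
  simp only [Finset.mem_range, Finset.mem_filter]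
  omega

section

variable {s : ℕ} {B : NestedBases F s} {α : Fin s → F⟦X⟧} {C : Fin s → Matrix ℕ ℕ F}
  {P : Fin s → ℕ → F[X]}

theorem residue_combination (hP : ∀ m i (j : Fin m), B.basis m i j = residue m (P i j))
    {d m : ℕ} (h : d ≤ m) (c : ℕ → F) (i : Fin s) :
    residue m (∑ j ∈ Finset.range d, c j • P i j) =
      ∑ j : Fin m, (if (j : ℕ) < d then c j else 0) • B.basis m i j := by
  rw [sum_range_eq_sum_fin h, residue_sum]
  refine Finset.sum_congr rfl fun j _ => ?_
  rw [hP, ← residue_smul, ite_smul, zero_smul]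

theorem theta_residue_combination
    (hP : ∀ m i (j : Fin m), B.basis m i j = residue m (P i j))
    {d m : ℕ} (h : d ≤ m) (c : Fin s → ℕ → F) :
    theta B m (fun i => residue m (∑ j ∈ Finset.range d, c i j • P i j)) =
      fun ij => if (ij.2 : ℕ) < d then c ij.1 ij.2 else 0 := by
  funext ij
  change (B.basis m ij.1).repr (residue m _) ij.2 = _
  rw [residue_combination hP h, Module.Basis.repr_sum_self]

/-- Padded by zeros, `c` is the image under `theta B m` of the residues of its polynomial
combinations. Being orthogonal to the row space means lying in the double complement of `dualChain B
α m`, hence in `dualChain B α m` itself; as `theta` is injective, this is the hyperplane equation.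
-/
theorem IsGenerating.relation_truncated_iff (hC : IsGenerating B α C)
    (hP : ∀ m i (j : Fin m), B.basis m i j = residue m (P i j))
    {d m : ℕ} (h : d ≤ m) (c : Fin s → ℕ → F) :
    (∀ r < m, ∑ i, ∑ j ∈ Finset.range d, c i j * C i j r = 0) ↔
      ∀ n < m, PowerSeries.coeff n
        (∑ i, ((∑ j ∈ Finset.range d, c i j • P i j : F[X]) : F⟦X⟧) * α i) = 0 := by
  rw [← residue_mem_hyperplane α m (fun i => ∑ j ∈ Finset.range d, c i j • P i j),
    ← theta_mem_dualChain B α m, ← mem_orthogonal_orthogonal, ← hC m, mem_orthogonal_rowSpace,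
    theta_residue_combination hP h, Fin.forall_iff]
  refine forall₂_congr fun r hr => Eq.congr ?_ rfl
  rw [dotProduct, Fintype.sum_prod_type]
  refine Finset.sum_congr rfl fun i _ => ?_
  rw [sum_range_eq_sum_fin h]
  refine Finset.sum_congr rfl fun j _ => ?_
  simp only [overall, Matrix.of_apply, mul_ite, mul_zero]
  split_ifs
  · exact mul_comm _ _
  · rfl

theorem IsGenerating.relation_iff (hC : IsGenerating B α C)
    (hP : ∀ m i (j : Fin m), B.basis m i j = residue m (P i j)) (d : ℕ) (c : Fin s → ℕ → F) :
    (∀ r, ∑ i, ∑ j ∈ Finset.range d, c i j * C i j r = 0) ↔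
      ∑ i, (∑ j ∈ Finset.range d, c i j • P i j) • α i = 0 := by
  have hsmul : ∀ (p : F[X]) (a : F⟦X⟧), p • a = (p : F⟦X⟧) * a := fun p a => by
    rw [Algebra.smul_def]; rfl
  simp_rw [hsmul]
  constructor
  · intro h
    ext n
    -- The level must be at least `d` to hold all coefficients and exceed `n` to see the `n`-th
    -- power series coefficient.
    exact (hC.relation_truncated_iff hP (le_max_left d (n + 1)) c).1 (fun r _ => h r) n
      (lt_of_lt_of_le n.lt_succ_self (le_max_right _ _))
  · intro h r
    refine (hC.relation_truncated_iff hP (le_max_left d (r + 1)) c).2 (fun n _ => ?_) r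
      (lt_of_lt_of_le r.lt_succ_self (le_max_right _ _))
    rw [h, map_zero]

theorem coeff_eq_zero_of_combination_eq_zero
    (hP : ∀ m i (j : Fin m), B.basis m i j = residue m (P i j)) {d : ℕ} {c : ℕ → F} {i : Fin s}
    (h : ∑ j ∈ Finset.range d, c j • P i j = 0) : ∀ j < d, c j = 0 := by
  intro j hj
  have h1 := residue_combination hP le_rfl c i (d := d)
  rw [h, (residue_eq_zero_iff d 0).2 (dvd_zero _)] at h1
  have := Fintype.linearIndependent_iff.1 (B.basis d i).linearIndependent _ h1.symm ⟨j, hj⟩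
  simpa [hj] using this

/-- Expand the residue of `k` in the basis of level `d`; both sides have degree less than `d`, so
equality of residues is equality of polynomials. -/
theorem exists_combination_eq (hdeg : ∀ i j, (P i j).degree < ((j + 1 : ℕ) : WithBot ℕ))
    (hP : ∀ m i (j : Fin m), B.basis m i j = residue m (P i j)) {d : ℕ} (i : Fin s) {k : F[X]}
    (hk : k.degree < (d : WithBot ℕ)) :
    ∃ c : ℕ → F, ∑ j ∈ Finset.range d, c j • P i j = k := by
  refine ⟨fun j => if h : j < d then (B.basis d i).repr (residue d k) ⟨j, h⟩ else 0, ?_⟩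
  refine eq_of_residue_eq (m := d) ?_ hk ?_
  · refine Polynomial.mem_degreeLT.1 (Submodule.sum_mem _ fun j hj => Polynomial.mem_degreeLT.2 ?_)
    refine (Polynomial.degree_smul_le _ _).trans_lt ((hdeg i j).trans_le ?_)
    exact_mod_cast Finset.mem_range.1 hj
  · rw [residue_combination hP le_rfl]
    conv_rhs => rw [← (B.basis d i).sum_repr (residue d k)]
    refine Finset.sum_congr rfl fun j _ => ?_
    simp

/-- The rows of generating matrices of `α` are jointly linearly independent if and only if `α` is
linearly independent over the polynomial ring. -/
theorem IsGenerating.jointlyIndependent_iff (hC : IsGenerating B α C) :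
    JointlyIndependent C ↔ LinearIndependent F[X] α := by
  obtain ⟨P, hdeg, hP⟩ := B.exists_polynomials
  rw [Fintype.linearIndependent_iff]
  constructor
  · intro h k hk
    set d := Finset.univ.sup fun i => (k i).natDegree + 1
    have hkd : ∀ i, (k i).degree < (d : WithBot ℕ) := fun i =>
      Polynomial.degree_le_natDegree.trans_lt <| by
        exact_mod_cast (Finset.le_sup (f := fun i => (k i).natDegree + 1) (Finset.mem_univ i))
    choose c hc using fun i => exists_combination_eq hdeg hP i (hkd i)
    have := h d c ((hC.relation_iff hP d c).2 (by simp_rw [hc]; exact hk))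
    intro i
    rw [← hc i]
    exact Finset.sum_eq_zero fun j hj => by rw [this i j (Finset.mem_range.1 hj), zero_smul]
  · intro h d c hc i
    exact coeff_eq_zero_of_combination_eq_zero hP (h _ ((hC.relation_iff hP d c).1 hc) i)

end

end Algebra

/-! ### Asymptotic frequencies and approximation of boxes by cells -/

section Frequency

/-- The natural numbers with property `p` have asymptotic frequency `v`. -/
def HasFrequency (p : ℕ → Prop) (v : ℝ) : Prop :=
  Tendsto (fun N : ℕ => (Set.ncard {n : ℕ | n < N ∧ p n} : ℝ) / N) atTop (𝓝 v)

theorem ncard_lt_and_eq_count (p : ℕ → Prop) [DecidablePred p] (N : ℕ) :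
    Set.ncard {n : ℕ | n < N ∧ p n} = Nat.count p N := by
  rw [Nat.count_eq_card_filter_range, ← Set.ncard_coe_finset]
  congr 1
  ext n
  simp

theorem ncard_lt_and_mono {p p' : ℕ → Prop} (h : ∀ n, p n → p' n) (N : ℕ) :
    Set.ncard {n : ℕ | n < N ∧ p n} ≤ Set.ncard {n : ℕ | n < N ∧ p' n} :=
  Set.ncard_le_ncard (fun n hn => ⟨hn.1, h n hn.2⟩) ((Set.finite_lt_nat N).subset fun _ hn => hn.1)

theorem HasFrequency.mem_finset {β : Type*} {g : ℕ → β} {S : Finset β} {v : ℝ}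
    (h : ∀ u ∈ S, HasFrequency (fun n => g n = u) v) :
    HasFrequency (fun n => g n ∈ S) (S.card * v) := by
  classical
  have := tendsto_finsetSum S h
  rw [Finset.sum_const, nsmul_eq_mul] at this
  refine this.congr fun N => ?_
  rw [← Finset.sum_div]
  congr 1
  simp only [ncard_lt_and_eq_count, Nat.count_eq_card_filter_range]
  rw [Finset.card_eq_sum_card_fiberwise (f := g) (s := (Finset.range N).filter fun n => g n ∈ S)
    (t := S) fun n hn => (Finset.mem_filter.1 hn).2]
  push_cast
  refine Finset.sum_congr rfl fun u hu => ?_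
  congr 2
  ext n
  simp only [Finset.mem_filter]
  constructor
  · rintro ⟨h1, h2⟩
    exact ⟨⟨h1, h2 ▸ hu⟩, h2⟩
  · rintro ⟨⟨h1, -⟩, h2⟩
    exact ⟨h1, h2⟩

theorem count_mul_of_blocks {p : ℕ → Prop} [DecidablePred p] {M t : ℕ}
    (h : ∀ a, Nat.count (fun k => p (a * M + k)) M = t) (a : ℕ) : Nat.count p (a * M) = a * t := by
  induction a with
  | zero => simp
  | succ a ih => rw [Nat.succ_mul, Nat.count_add, ih, h, Nat.succ_mul]

/-- Only the last, incomplete block can deviate, so the count up to `N` differs from `N * t / M` by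
at most `t`. -/
theorem HasFrequency.of_blocks {p : ℕ → Prop} [DecidablePred p] {M t : ℕ} (hM : 0 < M)
    (h : ∀ a, Nat.count (fun k => p (a * M + k)) M = t) : HasFrequency p (t / M) := by
  have hM' : (0 : ℝ) < M := by exact_mod_cast hM
  rw [HasFrequency, tendsto_iff_norm_sub_tendsto_zero]
  refine squeeze_zero' (Eventually.of_forall fun _ => norm_nonneg _) ?_
    (tendsto_const_div_atTop_nhds_zero_nat (t : ℝ))
  filter_upwards [eventually_gt_atTop 0] with N hN
  have hN' : (0 : ℝ) < N := by exact_mod_cast hN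
  have h1 : ((N / M : ℕ) : ℝ) * t ≤ Nat.count p N := by
    exact_mod_cast (count_mul_of_blocks h (N / M)) ▸ Nat.count_monotone p (Nat.div_mul_le_self N M)
  have h2 : (Nat.count p N : ℝ) ≤ ((N / M : ℕ) + 1 : ℝ) * t := by
    have := Nat.count_monotone p (Nat.lt_div_mul_add hM (a := N)).le
    rw [← Nat.succ_mul, count_mul_of_blocks h] at this
    exact_mod_cast this
  have h3 : ((N / M : ℕ) : ℝ) ≤ N / M := Nat.cast_div_le
  have h4 : (N : ℝ) / M ≤ (N / M : ℕ) + 1 := by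
    rw [div_le_iff₀ hM']
    have := (Nat.lt_div_mul_add hM (a := N)).le
    rw [← Nat.succ_mul] at this
    exact_mod_cast this
  have ht : (0 : ℝ) ≤ t := t.cast_nonneg
  rw [ncard_lt_and_eq_count, Real.norm_eq_abs,
    show (Nat.count p N : ℝ) / N - t / M = (Nat.count p N - N / M * t) / N by field_simp,
    abs_div, abs_of_pos hN']
  gcongr
  rw [abs_le]
  constructor
  · nlinarith
  · nlinarith

theorem tendsto_prod_add_div {s : ℕ} (l : Fin s → ℝ) (c : ℝ) {Q : ℕ → ℕ}
    (hQ : Tendsto Q atTop atTop) :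
    Tendsto (fun d => ∏ i, (l i + c / (Q d : ℝ))) atTop (𝓝 (∏ i, l i)) := by
  refine tendsto_finsetProd _ fun i _ => ?_
  have := ((tendsto_const_div_atTop_nhds_zero_nat c).comp hQ).const_add (l i)
  simpa using this

/-- One unit is lost by rounding `a * Q` up, another by the final `- 1`. The latter is needed
because cells are closed: it keeps their right endpoints strictly below `b`. -/
theorem innerCells_card {a b : ℝ} (ha : 0 ≤ a) {Q : ℕ} (hQ : 0 < Q) :
    (b - a + (-2) / Q) * Q ≤ ((Finset.Ico ⌈a * Q⌉₊ (⌈b * Q⌉₊ - 1)).card : ℝ) := by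
  have hQ' : (0 : ℝ) < Q := by exact_mod_cast hQ
  have h1 := Nat.ceil_lt_add_one (a := a * Q) (by positivity)
  have h2 := Nat.le_ceil (b * Q)
  have h3 : (⌈b * Q⌉₊ : ℝ) ≤ ((Finset.Ico ⌈a * Q⌉₊ (⌈b * Q⌉₊ - 1)).card : ℝ) + 1 + ⌈a * Q⌉₊ := by
    rw [Nat.card_Ico]
    exact_mod_cast (by omega)
  have h4 : (b - a + (-2) / Q) * Q = b * Q - a * Q - 2 := by field_simp; ring
  linarith

open Classical in
/-- The cells `[u/Q, (u+1)/Q]` that meet `[a, b)` or contain `1`. -/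
noncomputable def outerCells (a b : ℝ) (Q : ℕ) : Finset ℕ :=
  (Finset.range Q).filter fun u => u + 1 = Q ∨ (a * Q ≤ u + 1 ∧ u ≤ b * Q)

/-- The excess `3` pays for the boundary cells at both ends and for the last cell, which is always
included. -/
theorem outerCells_card {a b : ℝ} (ha : 0 ≤ a) (hab : a < b) {Q : ℕ} (hQ : 0 < Q) :
    ((outerCells a b Q).card : ℝ) ≤ (b - a + 3 / Q) * Q := by
  have hQ' : (0 : ℝ) < Q := by exact_mod_cast hQ
  have hsub : outerCells a b Q ⊆ insert (Q - 1) (Finset.Ico (⌈a * Q⌉₊ - 1) (⌊b * Q⌋₊ + 1)) := by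
    intro u hu
    obtain ⟨-, hu⟩ := Finset.mem_filter.1 hu
    rw [Finset.mem_insert, Finset.mem_Ico]
    rcases hu with h | ⟨h1, h2⟩
    · left; omega
    · right
      have h1' : ⌈a * Q⌉₊ ≤ u + 1 := Nat.ceil_le.2 (by exact_mod_cast h1)
      have h2' := Nat.le_floor h2
      omega
  have h1 := (Finset.card_le_card hsub).trans (Finset.card_insert_le _ _)
  rw [Nat.card_Ico] at h1
  have h2 := Nat.floor_le (a := b * Q) (by nlinarith)
  have h3 := Nat.le_ceil (a * Q)
  have h4 : ⌈a * Q⌉₊ ≤ ⌊b * Q⌋₊ + 1 :=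
    (Nat.ceil_le_floor_add_one _).trans
      (Nat.succ_le_succ (Nat.floor_mono (by nlinarith)))
  have h5 : ((outerCells a b Q).card : ℝ) + ⌈a * Q⌉₊ ≤ ⌊b * Q⌋₊ + 3 := by
    exact_mod_cast (by omega)
  have h6 : (b - a + 3 / Q) * Q = b * Q - a * Q + 3 := by field_simp
  linarith

/-- If for arbitrarily fine partitions of the unit cube into `Q^s` cells all cells are hit with the
same frequency, then the sequence is uniformly distributed. -/
theorem uniformlyDistributedModOne_of_cells {s : ℕ} {x : ℕ → Fin s → ℝ} {Q : ℕ → ℕ}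
    (hQ : ∀ d, 0 < Q d) (hQ' : Tendsto Q atTop atTop) (g : ℕ → ℕ → Fin s → ℕ)
    (hg : ∀ d n i, g d n i < Q d)
    (hx : ∀ d n i, (g d n i : ℝ) ≤ x n i * Q d ∧ x n i * Q d ≤ g d n i + 1)
    (hfreq : ∀ d (u : Fin s → ℕ), (∀ i, u i < Q d) →
      HasFrequency (fun n => g d n = u) (1 / (Q d : ℝ) ^ s)) :
    UniformlyDistributedModOne x := by
  intro a b hab
  have hpos : ∀ d, (0 : ℝ) < Q d := fun d => by exact_mod_cast hQ d
  have hcard : ∀ d (A : Fin s → Finset ℕ), (∀ i, ∀ u ∈ A i, u < Q d) →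
      HasFrequency (fun n => g d n ∈ Fintype.piFinset A) (∏ i, ((A i).card / (Q d : ℝ))) := by
    intro d A hA
    have := HasFrequency.mem_finset (S := Fintype.piFinset A) (g := g d) fun u hu =>
      hfreq d u fun i => hA i _ (Fintype.mem_piFinset.1 hu i)
    rw [Fintype.card_piFinset] at this
    convert this using 1
    rw [Finset.prod_div_distrib]
    simp [div_eq_mul_inv]
  have hx0 : ∀ n i, 0 ≤ x n i := fun n i =>
    nonneg_of_mul_nonneg_left ((Nat.cast_nonneg _).trans (hx 0 n i).1) (hpos 0)
  have hx1 : ∀ n i, x n i ≤ 1 := fun n i => by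
    have h1 := (hx 0 n i).2
    have h2 : ((g 0 n i : ℝ) + 1) ≤ Q 0 := by exact_mod_cast hg 0 n i
    exact le_of_mul_le_mul_right (by linarith) (hpos 0)
  rw [tendsto_order]
  constructor
  · intro v hv
    -- Besides a product above `v`, each single factor must be positive so that the products can be
    -- compared factorwise.
    obtain ⟨d, hd1, hd2⟩ := (((tendsto_prod_add_div (fun i => b i - a i) (-2) hQ').eventually
      (lt_mem_nhds hv)).and ((eventually_all.2 fun i =>
        ((((tendsto_const_div_atTop_nhds_zero_nat (-2 : ℝ)).comp hQ').const_add
          (b i - a i)).eventually (lt_mem_nhds (a := 0) (by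
            rw [add_zero]; exact sub_pos.2 (hab i).2.1)))))).exists
    have hF := hcard d (fun i => Finset.Ico ⌈a i * Q d⌉₊ (⌈b i * Q d⌉₊ - 1)) (by
      intro i u hu
      have h1 : u + 1 < ⌈b i * Q d⌉₊ := by
        have := (Finset.mem_Ico.1 hu).2
        omega
      have h2 := Nat.lt_ceil.1 h1
      have h3 : b i * Q d ≤ Q d := mul_le_of_le_one_left (hpos d).le (hab i).2.2
      have h4 : ((u + 1 : ℕ) : ℝ) < Q d := h2.trans_le h3
      have := Nat.cast_lt.1 h4
      omega)
    have hlt : v < ∏ i, (((Finset.Ico ⌈a i * Q d⌉₊ (⌈b i * Q d⌉₊ - 1)).card : ℝ) / (Q d : ℝ)) := by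
      refine hd1.trans_le (Finset.prod_le_prod (fun i _ => (hd2 i).le) fun i _ => ?_)
      rw [le_div_iff₀ (hpos d)]
      exact innerCells_card (hab i).1 (hQ d)
    filter_upwards [hF.eventually (lt_mem_nhds hlt)] with N hN
    refine hN.trans_le ?_
    refine div_le_div_of_nonneg_right (Nat.cast_le.2 (ncard_lt_and_mono (fun n hn => ?_) N))
      (Nat.cast_nonneg N)
    intro i
    have hni := Finset.mem_Ico.1 (Fintype.mem_piFinset.1 hn i)
    have h1 : g d n i + 1 < ⌈b i * Q d⌉₊ := by omega
    have h2 := Nat.lt_ceil.1 h1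
    push_cast at h2
    have h3 : x n i < b i := lt_of_mul_lt_mul_right ((hx d n i).2.trans_lt h2) (hpos d).le
    rw [Int.fract_eq_self.2 ⟨hx0 n i, h3.trans_le (hab i).2.2⟩]
    exact ⟨le_of_mul_le_mul_right ((Nat.ceil_le.1 hni.1).trans (hx d n i).1) (hpos d), h3⟩
  · intro v hv
    obtain ⟨d, hd1⟩ := ((tendsto_prod_add_div (fun i => b i - a i) 3 hQ').eventually
      (gt_mem_nhds hv)).exists
    have hF := hcard d (fun i => outerCells (a i) (b i) (Q d)) (by
      intro i u hu
      exact Finset.mem_range.1 (Finset.mem_filter.1 hu).1)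
    have hlt : ∏ i, (((outerCells (a i) (b i) (Q d)).card : ℝ) / (Q d : ℝ)) < v := by
      refine (Finset.prod_le_prod (fun i _ => by positivity) fun i _ => ?_).trans_lt hd1
      rw [div_le_iff₀ (hpos d)]
      exact outerCells_card (hab i).1 (hab i).2.1 (hQ d)
    filter_upwards [hF.eventually (gt_mem_nhds hlt)] with N hN
    refine lt_of_le_of_lt ?_ hN
    refine div_le_div_of_nonneg_right (Nat.cast_le.2 (ncard_lt_and_mono (fun n hn => ?_) N))
      (Nat.cast_nonneg N)
    refine Fintype.mem_piFinset.2 fun i => ?_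
    refine Finset.mem_filter.2 ⟨Finset.mem_range.2 (hg d n i), ?_⟩
    -- A coordinate may equal `1` (all digits maximal). Its fractional part is then `0`, which does
    -- not locate the point; it lies in the last cell.
    rcases (hx1 n i).eq_or_lt with h1 | h1
    · left
      have h2 := (hx d n i).2
      rw [h1, one_mul] at h2
      have h3 : Q d ≤ g d n i + 1 := by exact_mod_cast h2
      exact le_antisymm (hg d n i) h3
    · right
      have h2 := hn i
      rw [Int.fract_eq_self.2 ⟨hx0 n i, h1⟩] at h2
      exact ⟨(mul_le_mul_of_nonneg_right h2.1 (hpos d).le).trans (hx d n i).2,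
        (hx d n i).1.trans (mul_le_mul_of_nonneg_right h2.2.le (hpos d).le)⟩

/-- If a cell of the unit cube contains no point of the sequence, then the sequence is not uniformly
distributed. -/
theorem not_uniformlyDistributedModOne_of_cell {s : ℕ} {x : ℕ → Fin s → ℝ} {Q : ℕ}
    (g : ℕ → Fin s → ℕ) (hg : ∀ n i, g n i < Q)
    (hx : ∀ n i, (g n i : ℝ) ≤ x n i * Q ∧ x n i * Q ≤ g n i + 1)
    {u : Fin s → ℕ} (hu : ∀ i, u i < Q) (hgu : ∀ n, g n ≠ u) :
    ¬ UniformlyDistributedModOne x := by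
  intro h
  rcases Q.eq_zero_or_pos with rfl | hQ
  · refine hgu 0 (funext fun i => absurd (hu i) (Nat.not_lt_zero _))
  have hpos : (0 : ℝ) < Q := by exact_mod_cast hQ
  have huQ : ∀ i, (u i : ℝ) + 1 ≤ Q := fun i => by exact_mod_cast hu i
  -- The middle third of the cell avoids closed neighbouring cells, and its positive left end
  -- excludes the fractional part `0` of a coordinate equal to `1`.
  have h1 := h (fun i => (u i + 1 / 3) / Q) (fun i => (u i + 2 / 3) / Q) fun i =>
    ⟨by positivity, by gcongr; norm_num, by rw [div_le_one hpos]; linarith [huQ i]⟩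
  have hempty : ∀ N : ℕ, {n : ℕ | n < N ∧ ∀ i, Int.fract (x n i) ∈
      Set.Ico (((u i : ℝ) + 1 / 3) / Q) ((u i + 2 / 3) / Q)} = ∅ := by
    intro N
    refine Set.eq_empty_iff_forall_notMem.2 fun n hn => hgu n (funext fun i => ?_)
    have h2 := hn.2 i
    have hx0 : 0 ≤ x n i := nonneg_of_mul_nonneg_left ((Nat.cast_nonneg _).trans (hx n i).1) hpos
    have hx1 : x n i ≤ 1 := by
      have h3 : ((g n i : ℝ) + 1) ≤ Q := by exact_mod_cast hg n i
      exact le_of_mul_le_mul_right (by linarith [(hx n i).2]) hpos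
    have hne : x n i ≠ 1 := by
      intro h3
      rw [h3, Int.fract_one] at h2
      have : 0 < ((u i : ℝ) + 1 / 3) / Q := by positivity
      linarith [h2.1]
    rw [Int.fract_eq_self.2 ⟨hx0, lt_of_le_of_ne hx1 hne⟩] at h2
    have h3 := (div_le_iff₀ hpos).1 h2.1
    have h4 := (lt_div_iff₀ hpos).1 h2.2
    have h5 : (g n i : ℝ) < u i + 1 := by linarith [(hx n i).1]
    have h6 : (u i : ℝ) < g n i + 1 := by linarith [(hx n i).2]
    have h5' : g n i < u i + 1 := by exact_mod_cast h5
    have h6' : u i < g n i + 1 := by exact_mod_cast h6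
    omega
  simp only [hempty, Set.ncard_empty, Nat.cast_zero, zero_div] at h1
  have h2 := tendsto_nhds_unique h1 tendsto_const_nhds
  refine (Finset.prod_pos fun i _ => ?_).ne' h2
  rw [← sub_div]
  have : (0 : ℝ) < u i + 2 / 3 - (u i + 1 / 3) := by norm_num
  positivity

end Frequency

/-! ### Digit expansions and cells -/

section Cells

/-- Words of length `d` over `{0, …, q-1}` number the cells of length `q^{-d}` of the unit interval,
with the leading digit first. -/
def cellIndex (q d : ℕ) : (Fin d → Fin q) ≃ Fin (q ^ d) :=
  (Equiv.arrowCongr Fin.revPerm (Equiv.refl _)).trans finFunctionFinEquiv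

theorem cellIndex_apply (q d : ℕ) (w : Fin d → Fin q) :
    (cellIndex q d w : ℕ) = ∑ j : Fin d, (w j : ℕ) * q ^ (d - 1 - j) := by
  rw [cellIndex, Equiv.trans_apply, finFunctionFinEquiv_apply, ← Equiv.sum_comp Fin.revPerm]
  refine Finset.sum_congr rfl fun j _ => ?_
  simp [Nat.sub_sub, add_comm 1]

/-- Scaling by `q ^ d` turns the first `d` digits into the integer cell index and leaves the shifted
expansion, which lies in `[0, 1]`. The value `1` is possible, so cells are closed. -/
theorem ofDigits_mem_cell {q : ℕ} (D : ℕ → Fin q) (d : ℕ) :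
    ((cellIndex q d fun j => D j : ℕ) : ℝ) ≤ Real.ofDigits D * (q ^ d : ℕ) ∧
      Real.ofDigits D * (q ^ d : ℕ) ≤ (cellIndex q d fun j => D j : ℕ) + 1 := by
  have hq : (0 : ℝ) < q := by exact_mod_cast (Fin.pos (D 0))
  have h1 : (∑ j ∈ Finset.range d, Real.ofDigitsTerm D j) * (q ^ d : ℕ) =
      ((cellIndex q d fun j => D j : ℕ) : ℝ) := by
    rw [cellIndex_apply, Fin.sum_univ_eq_sum_range (fun j => (D j : ℕ) * q ^ (d - 1 - j)),
      Finset.sum_mul, Nat.cast_sum]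
    refine Finset.sum_congr rfl fun j hj => ?_
    have hj := Finset.mem_range.1 hj
    have : (q : ℝ) ^ d = q ^ (j + 1) * q ^ (d - 1 - j) := by
      rw [← pow_add]; congr 1; omega
    rw [Real.ofDigitsTerm]
    push_cast
    rw [this]
    field_simp
  have h2 : Real.ofDigits D * (q ^ d : ℕ) =
      (cellIndex q d fun j => D j : ℕ) + Real.ofDigits fun j => D (j + d) := by
    rw [Real.ofDigits_eq_sum_add_ofDigits D d, add_mul, h1]
    push_cast
    field_simp
  rw [h2]
  have h3 := Real.ofDigits_nonneg fun j => D (j + d)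
  have h4 := Real.ofDigits_le_one fun j => D (j + d)
  constructor <;> linarith

theorem exists_digits_of_cell {F : Type*} [Fintype F] {s : ℕ}
    (φ : Fin (Fintype.card F) ≃ F) {d : ℕ} {u : Fin s → ℕ}
    (hu : ∀ i, u i < Fintype.card F ^ d) : ∃ w : Fin s × Fin d → F,
      u = fun i => (cellIndex (Fintype.card F) d fun j => φ.symm (w (i, j)) : ℕ) := by
  refine ⟨fun ij => φ ((cellIndex (Fintype.card F) d).symm ⟨u ij.1, hu ij.1⟩ ij.2), ?_⟩
  funext i
  simp only [Equiv.symm_apply_apply]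
  exact (congrArg Fin.val ((cellIndex _ d).apply_symm_apply ⟨u i, hu i⟩)).symm

end Cells

/-! ### Surjectivity of the leading rows and fibre sizes -/

section LeadingRows

variable {F : Type*} [Field F] {s : ℕ}

/-- The first `m` columns of the first `d` rows of `C_1, …, C_s`. -/
def leadingRows (C : Fin s → Matrix ℕ ℕ F) (d m : ℕ) : Matrix (Fin s × Fin d) (Fin m) F :=
  Matrix.of fun ij r => C ij.1 ij.2 r

/-- A proper range would be killed by a nonzero functional `c`; evaluating it on the unit vectors
makes `c` a relation among the truncated rows. -/
theorem leadingRows_mulVec_surjective {C : Fin s → Matrix ℕ ℕ F} {d m : ℕ}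
    (h : ∀ c : Fin s × Fin d → F, (∀ r < m, ∑ ij, c ij * C ij.1 ij.2 r = 0) → c = 0) :
    Function.Surjective (leadingRows C d m).mulVecLin := by
  classical
  rw [← LinearMap.range_eq_top]
  by_contra hne
  obtain ⟨f, hf, hle⟩ := Submodule.exists_le_ker_of_lt_top _ (lt_top_iff_ne_top.2 hne)
  obtain ⟨c, rfl⟩ := (dotProductEquiv F (Fin s × Fin d)).surjective f
  refine hf ?_
  rw [h c fun r hr => ?_, map_zero]
  have := hle ⟨Pi.single (⟨r, hr⟩ : Fin m) 1, rfl⟩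
  rw [LinearMap.mem_ker, Matrix.mulVecLin_apply, Matrix.mulVec_single_one] at this
  exact this

theorem card_fiber_mul_card {G H : Type*} [AddGroup G] [AddGroup H] [Fintype G] [Fintype H]
    [DecidableEq H] (f : G →+ H) (hf : Function.Surjective f) (y : H) :
    (Finset.univ.filter fun x => f x = y).card * Fintype.card H = Fintype.card G := by
  have h := Finset.card_eq_sum_card_fiberwise (f := f) (s := Finset.univ) (t := Finset.univ)
    fun x _ => Finset.mem_coe.2 (Finset.mem_univ _)
  rw [← Finset.card_univ (α := G), h, Finset.sum_congr rfl fun z _ =>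
    AddMonoidHom.card_fiber_eq_of_mem_range f (hf z) (hf y), Finset.sum_const, Finset.card_univ,
    smul_eq_mul, mul_comm]

end LeadingRows

/-! ### Equidistribution of digital sequences -/

section Digital

variable {F : Type*} [Field F] [Fintype F]

theorem digit_add_of_lt {a k m r : ℕ} (hr : r < m) :
    digit F (a * Fintype.card F ^ m + k) r = digit F k r := by
  have hq : 0 < Fintype.card F := Fintype.card_pos
  refine Fin.ext ?_
  change (_ + k) / _ % _ = k / _ % _
  obtain ⟨t, rfl⟩ := Nat.exists_eq_add_of_lt hr
  rw [show a * Fintype.card F ^ (r + t + 1) + k =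
    k + Fintype.card F ^ r * (Fintype.card F * (a * Fintype.card F ^ t)) by ring,
    Nat.add_mul_div_left _ _ (pow_pos hq r), Nat.add_mul_mod_self_left]

theorem digit_add_of_le {a k m r : ℕ} (hk : k < Fintype.card F ^ m) (hr : m ≤ r) :
    digit F (a * Fintype.card F ^ m + k) r = digit F (a * Fintype.card F ^ m) r := by
  have hq : 0 < Fintype.card F := Fintype.card_pos
  refine Fin.ext ?_
  change (_ + k) / _ % _ = _ / _ % _
  obtain ⟨t, rfl⟩ := Nat.exists_eq_add_of_le hr
  rw [pow_add, ← Nat.div_div_eq_div_mul, ← Nat.div_div_eq_div_mul, add_comm,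
    Nat.add_mul_div_right _ _ (pow_pos hq m), Nat.div_eq_of_lt hk, zero_add,
    Nat.mul_div_cancel _ (pow_pos hq m)]

variable {φ : Fin (Fintype.card F) ≃ F}

theorem apply_digit_eq_zero (hφ : ((φ.symm 0 : Fin (Fintype.card F)) : ℕ) = 0) {k r : ℕ}
    (h : (digit F k r : ℕ) = 0) : φ (digit F k r) = 0 := by
  rw [← Equiv.eq_symm_apply]
  exact Fin.ext (h.trans hφ.symm)

theorem digitalVec_eq_sum (hφ : ((φ.symm 0 : Fin (Fintype.card F)) : ℕ) = 0)
    (C : Matrix ℕ ℕ F) {k R : ℕ} (hk : k < Fintype.card F ^ R) (j : ℕ) :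
    digitalVec φ C k j = ∑ r ∈ Finset.range R, C j r * φ (digit F k r) := by
  refine finsum_eq_sum_of_support_subset _ fun r hr => ?_
  by_contra h
  refine hr ?_
  have hR : R ≤ r := by simpa using h
  have : k < Fintype.card F ^ r := hk.trans_le (Nat.pow_le_pow_right Fintype.card_pos hR)
  change C j r * φ (digit F k r) = 0
  rw [apply_digit_eq_zero hφ (by simp [digit, Nat.div_eq_of_lt this]), mul_zero]

theorem exists_lt_card_pow (k : ℕ) : ∃ R, k < Fintype.card F ^ R :=
  ⟨k, Nat.lt_pow_self Fintype.one_lt_card⟩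

/-- Adding `k < q ^ m` to a multiple of `q ^ m` causes no carries: the low digits are those of `k`,
the high ones those of the multiple. -/
theorem digitalVec_add (hφ : ((φ.symm 0 : Fin (Fintype.card F)) : ℕ) = 0)
    (C : Matrix ℕ ℕ F) {a k m : ℕ} (hk : k < Fintype.card F ^ m) (j : ℕ) :
    digitalVec φ C (a * Fintype.card F ^ m + k) j =
      ∑ r ∈ Finset.range m, C j r * φ (digit F k r) +
        digitalVec φ C (a * Fintype.card F ^ m) j := by
  obtain ⟨R₀, hR₀⟩ := exists_lt_card_pow (F := F) (a * Fintype.card F ^ m + k)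
  have hR : a * Fintype.card F ^ m + k < Fintype.card F ^ (m + R₀) :=
    hR₀.trans_le (Nat.pow_le_pow_right Fintype.card_pos (Nat.le_add_left _ _))
  rw [digitalVec_eq_sum hφ C hR, digitalVec_eq_sum hφ C ((Nat.le_add_right _ _).trans_lt hR),
    Finset.sum_range_add, Finset.sum_range_add, ← add_assoc]
  congr 1
  · have : ∑ r ∈ Finset.range m, C j r * φ (digit F (a * Fintype.card F ^ m) r) = 0 := by
      refine Finset.sum_eq_zero fun r hr => ?_
      have h0 := digit_add_of_lt (F := F) (a := a) (k := 0) (Finset.mem_range.1 hr)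
      rw [add_zero] at h0
      rw [h0, apply_digit_eq_zero hφ (by simp [digit]), mul_zero]
    rw [this, add_zero]
    exact Finset.sum_congr rfl fun r hr => by rw [digit_add_of_lt (Finset.mem_range.1 hr)]
  · exact Finset.sum_congr rfl fun r _ => by rw [digit_add_of_le hk (Nat.le_add_right _ _)]

variable {s : ℕ}

theorem JointlyIndependent.exists_truncation {C : Fin s → Matrix ℕ ℕ F}
    (hC : JointlyIndependent C) (d : ℕ) : ∃ m, ∀ c : Fin s × Fin d → F,
      (∀ r < m, ∑ ij, c ij * C ij.1 ij.2 r = 0) → c = 0 := by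
  classical
  -- Each nonzero `c` has a column witnessing that it is no relation; as `F` is finite there are
  -- finitely many `c`, and the largest witness bounds `m`.
  have h : ∀ c : Fin s × Fin d → F, ∃ r, c ≠ 0 → ∑ ij, c ij * C ij.1 ij.2 r ≠ 0 := by
    intro c
    by_contra! hc
    refine (hc 0).1 (funext fun ij => ?_)
    have := hC d (fun i j => if h : j < d then c (i, ⟨j, h⟩) else 0) (fun r => by
      rw [← (hc r).2, Fintype.sum_prod_type]
      refine Finset.sum_congr rfl fun i _ => ?_
      rw [Finset.sum_range]
      simp) ij.1 ij.2 ij.2.2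
    simpa using this
  choose r hr using h
  refine ⟨Finset.univ.sup r + 1, fun c hc => ?_⟩
  by_contra h0
  exact hr c h0 (hc _ (Nat.lt_succ_of_le (Finset.le_sup (Finset.mem_univ c))))

open Classical in
-- Within a block the low digits run once through `Fin m → F`, while the high digits add a constant
-- vector. The count is thus the number of solutions of an inhomogeneous linear system.
theorem count_block (hφ : ((φ.symm 0 : Fin (Fintype.card F)) : ℕ) = 0)
    (C : Fin s → Matrix ℕ ℕ F) (d m : ℕ) (w : Fin s × Fin d → F) (a : ℕ) :
    Nat.count (fun k => (fun ij : Fin s × Fin d =>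
      digitalVec φ (C ij.1) (a * Fintype.card F ^ m + k) ij.2) = w) (Fintype.card F ^ m) =
    (Finset.univ.filter fun κ : Fin m → F => (leadingRows C d m).mulVecLin κ =
      w - fun ij => digitalVec φ (C ij.1) (a * Fintype.card F ^ m) ij.2).card := by
  set t : Fin s × Fin d → F := fun ij =>
    digitalVec φ (C ij.1) (a * Fintype.card F ^ m) ij.2 with ht
  let e : Fin (Fintype.card F ^ m) ≃ (Fin m → F) :=
    finFunctionFinEquiv.symm.trans (Equiv.arrowCongr (Equiv.refl _) φ)
  have he : ∀ k r, e k r = φ (digit F k r) := fun k r =>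
    congrArg φ (Fin.ext (finFunctionFinEquiv_symm_apply_val k r))
  have key : ∀ k : Fin (Fintype.card F ^ m), (fun ij : Fin s × Fin d =>
      digitalVec φ (C ij.1) (a * Fintype.card F ^ m + k) ij.2) = w ↔
      (leadingRows C d m).mulVecLin (e k) = w - t := by
    intro k
    rw [eq_sub_iff_add_eq]
    refine Eq.congr (funext fun ij => ?_) rfl
    rw [digitalVec_add hφ _ k.2, Finset.sum_range]
    simp only [Pi.add_apply, Matrix.mulVecLin_apply, Matrix.mulVec, dotProduct, he, leadingRows,
      Matrix.of_apply, ht]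
  rw [Nat.count_eq_card_filter_range]
  refine Finset.card_bij (fun k hk => e ⟨k, Finset.mem_range.1 (Finset.mem_filter.1 hk).1⟩)
    (fun k hk => ?_) (fun k hk k' hk' h => ?_) (fun κ hκ => ?_)
  · exact Finset.mem_filter.2 ⟨Finset.mem_univ _, (key ⟨k, _⟩).1 (Finset.mem_filter.1 hk).2⟩
  · exact Fin.mk.inj (e.injective h)
  · have h := (key (e.symm κ)).2 (by rw [e.apply_symm_apply]; exact (Finset.mem_filter.1 hκ).2)
    exact ⟨e.symm κ, Finset.mem_filter.2 ⟨Finset.mem_range.2 (e.symm κ).2, h⟩,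
      e.apply_symm_apply κ⟩

theorem JointlyIndependent.hasFrequency_digits {C : Fin s → Matrix ℕ ℕ F}
    (hC : JointlyIndependent C) (hφ : ((φ.symm 0 : Fin (Fintype.card F)) : ℕ) = 0) (d : ℕ)
    (w : Fin s × Fin d → F) :
    HasFrequency (fun n => (fun ij : Fin s × Fin d => digitalVec φ (C ij.1) n ij.2) = w)
      (1 / ((Fintype.card F ^ d : ℕ) : ℝ) ^ s) := by
  classical
  obtain ⟨m, hm⟩ := hC.exists_truncation d
  have hcard : Fintype.card (Fin s × Fin d → F) = (Fintype.card F ^ d) ^ s := by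
    rw [Fintype.card_fun, Fintype.card_prod, Fintype.card_fin, Fintype.card_fin, mul_comm, pow_mul]
  have hQ : 0 < (Fintype.card F ^ d) ^ s := pow_pos (pow_pos Fintype.card_pos _) _
  have hM : 0 < Fintype.card F ^ m := pow_pos Fintype.card_pos _
  have hfib : ∀ v : Fin s × Fin d → F,
      (Finset.univ.filter fun κ : Fin m → F => (leadingRows C d m).mulVecLin κ = v).card *
        (Fintype.card F ^ d) ^ s = Fintype.card F ^ m := by
    intro v
    have := card_fiber_mul_card (leadingRows C d m).mulVecLin.toAddMonoidHom
      (leadingRows_mulVec_surjective hm) v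
    rw [hcard, Fintype.card_fun, Fintype.card_fin] at this
    exact this
  have h := HasFrequency.of_blocks
    (p := fun n => (fun ij : Fin s × Fin d => digitalVec φ (C ij.1) n ij.2) = w) hM
    (t := Fintype.card F ^ m / (Fintype.card F ^ d) ^ s) fun a => by
      rw [count_block hφ]
      exact Nat.eq_div_of_mul_eq_left hQ.ne' (hfib _)
  have hval : ((Fintype.card F ^ m / (Fintype.card F ^ d) ^ s : ℕ) : ℝ) / (Fintype.card F ^ m : ℕ) =
      1 / ((Fintype.card F ^ d : ℕ) : ℝ) ^ s := by
    have h0 := Nat.div_mul_cancel (Dvd.intro_left _ (hfib 0))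
    have h1 : (0 : ℝ) < (Fintype.card F ^ m : ℕ) := by exact_mod_cast hM
    have h2 : (0 : ℝ) < ((Fintype.card F ^ d : ℕ) : ℝ) ^ s := by exact_mod_cast hQ
    rw [div_eq_div_iff h1.ne' h2.ne', one_mul]
    exact_mod_cast h0
  rwa [hval] at h

/-- The cells of length `q^{-d}` that contain the coordinates of the `n`-th point. -/
noncomputable def digitalCell (φ : Fin (Fintype.card F) ≃ F) (C : Fin s → Matrix ℕ ℕ F) (d n : ℕ)
    (i : Fin s) : ℕ :=
  cellIndex (Fintype.card F) d fun j => φ.symm (digitalVec φ (C i) n j)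

theorem digitalCell_lt (C : Fin s → Matrix ℕ ℕ F) (d n : ℕ) (i : Fin s) :
    digitalCell φ C d n i < Fintype.card F ^ d :=
  Fin.is_lt _

theorem digitalSeq_mem_cell (C : Fin s → Matrix ℕ ℕ F) (d n : ℕ) (i : Fin s) :
    (digitalCell φ C d n i : ℝ) ≤ digitalSeq φ C n i * (Fintype.card F ^ d : ℕ) ∧
      digitalSeq φ C n i * (Fintype.card F ^ d : ℕ) ≤ digitalCell φ C d n i + 1 :=
  ofDigits_mem_cell (fun j => φ.symm (digitalVec φ (C i) n j)) d

theorem digitalCell_eq_iff (C : Fin s → Matrix ℕ ℕ F) (d n : ℕ) (w : Fin s × Fin d → F) :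
    digitalCell φ C d n =
        (fun i => (cellIndex (Fintype.card F) d fun j => φ.symm (w (i, j)) : ℕ)) ↔
      (fun ij : Fin s × Fin d => digitalVec φ (C ij.1) n ij.2) = w := by
  constructor
  · intro h
    funext ij
    exact φ.symm.injective
      (congrFun ((cellIndex _ d).injective (Fin.ext (congrFun h ij.1))) ij.2)
  · rintro rfl
    rfl

theorem JointlyIndependent.uniformlyDistributedModOne {C : Fin s → Matrix ℕ ℕ F}
    (hC : JointlyIndependent C) (hφ : ((φ.symm 0 : Fin (Fintype.card F)) : ℕ) = 0) :
    UniformlyDistributedModOne (digitalSeq φ C) := by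
  refine uniformlyDistributedModOne_of_cells (Q := fun d => Fintype.card F ^ d)
    (fun d => pow_pos Fintype.card_pos d)
    (tendsto_pow_atTop_atTop_of_one_lt Fintype.one_lt_card) (digitalCell φ C) (digitalCell_lt C)
    (digitalSeq_mem_cell C) fun d u hu => ?_
  obtain ⟨w, rfl⟩ := exists_digits_of_cell φ hu
  simp_rw [digitalCell_eq_iff]
  exact hC.hasFrequency_digits hφ d w

theorem jointlyIndependent_of_uniformlyDistributedModOne {C : Fin s → Matrix ℕ ℕ F}
    (hφ : ((φ.symm 0 : Fin (Fintype.card F)) : ℕ) = 0)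
    (h : UniformlyDistributedModOne (digitalSeq φ C)) : JointlyIndependent C := by
  classical
  intro d c hc i₀ j₀ hj₀
  by_contra hne
  have hrel : ∀ n, ∑ i, ∑ j ∈ Finset.range d, c i j * digitalVec φ (C i) n j = 0 := by
    intro n
    obtain ⟨R, hR⟩ := exists_lt_card_pow (F := F) n
    calc ∑ i, ∑ j ∈ Finset.range d, c i j * digitalVec φ (C i) n j
        = ∑ r ∈ Finset.range R,
            (∑ i, ∑ j ∈ Finset.range d, c i j * C i j r) * φ (digit F n r) := by
          simp_rw [digitalVec_eq_sum hφ _ hR, Finset.mul_sum, Finset.sum_mul]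
          symm
          rw [Finset.sum_comm]
          refine Finset.sum_congr rfl fun i _ => ?_
          rw [Finset.sum_comm]
          simp_rw [mul_assoc]
      _ = 0 := Finset.sum_eq_zero fun r _ => by rw [hc r, zero_mul]
  -- If a point had these digits, the relation would reduce to `c i₀ j₀ = 0`.
  let w : Fin s × Fin d → F := Pi.single (i₀, ⟨j₀, hj₀⟩) 1
  refine not_uniformlyDistributedModOne_of_cell (digitalCell φ C d) (digitalCell_lt C d)
    (digitalSeq_mem_cell C d)
    (u := fun i => (cellIndex (Fintype.card F) d fun j => φ.symm (w (i, j)) : ℕ))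
    (fun i => Fin.is_lt _) (fun n hn => hne ?_) h
  rw [digitalCell_eq_iff] at hn
  have h1 := hrel n
  simp_rw [Finset.sum_range] at h1
  rw [← Fintype.sum_prod_type' (f := fun i (j : Fin d) => c i j * digitalVec φ (C i) n j),
    Finset.sum_congr rfl fun ij _ => congrArg (c ij.1 ij.2 * ·) (congrFun hn ij)] at h1
  simpa [w, Pi.single_apply] using h1

theorem digitalSeq_uniformlyDistributedModOne_iff (C : Fin s → Matrix ℕ ℕ F)
    (hφ : ((φ.symm 0 : Fin (Fintype.card F)) : ℕ) = 0) :
    UniformlyDistributedModOne (digitalSeq φ C) ↔ JointlyIndependent C :=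
  ⟨jointlyIndependent_of_uniformlyDistributedModOne hφ, fun h => h.uniformlyDistributedModOne hφ⟩

end Digital

end HyperplaneSeq

theorem mainTheorem3 {F : Type*} [Field F] [Fintype F]
    (φ : Fin (Fintype.card F) ≃ F) (hφ : ((φ.symm 0 : Fin (Fintype.card F)) : ℕ) = 0)
    {s : ℕ} (hs : 1 ≤ s) (B : HyperplaneSeq.NestedBases F s)
    (α : Fin s → PowerSeries F) (hα : ∀ i, α i ∈ HyperplaneSeq.Y F)
    (x : ℕ → Fin s → ℝ) (hx : HyperplaneSeq.IsHyperplaneSeq φ B α x) :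
    HyperplaneSeq.UniformlyDistributedModOne x ↔
      LinearIndependent (Polynomial F) α := by
  obtain ⟨C, hC, rfl⟩ := hx
  rw [HyperplaneSeq.digitalSeq_uniformlyDistributedModOne_iff C hφ, hC.jointlyIndependent_iff]
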